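/- Let $P$ be a smooth ($C^\infty$) finite-dimensional Hausdorff manifold without boundary, $\pi^*:T^*P\to P$ its cotangent bundle, and let $\mathrm{Aut}_0TP$ be the group, under composition, of smooth vector bundle automorphisms of $TP$ covering $\mathrm{id}_P$: an element $A$ is a family of linear isomorphisms $A(p):T_pP\to T_pP$ depending smoothly on $p$. A linear vector field on $T^*P$ is a pair $(\xi,\chi)$ of smooth vector fields on $T^*P$ and $P$ such that $\xi:T^*P\to T(T^*P)$ is a morphism of vector bundles over $\chi:P\to TP$; here $T\pi^*:T(T^*P)\to TP$ carries the vector bundle structure whose fibrewise addition and scalar multiplication are the tangent maps of those of $T^*P$. A generalized canonical form on $T^*P$ is a smooth one-form $\gamma$ on $T^*P$ such that (i) $\gamma_\varphi\neq 0$ for every $\varphi\in T^*P$ outside the zero section; (ii) $\ker T\pi^*(\varphi)\subset\ker\gamma_\varphi$ for every $\varphi\in T^*P$; (iii) for every linear vector field $(\xi,\chi)$ the function $\langle\gamma,\xi\rangle$ on $T^*P$ is smooth and linear on the fibres of $T^*P$. Let $\mathrm{Can}\,T^*P$ be the set of generalized canonical forms. Then: (1) The map $\Theta:\mathrm{Aut}_0TP\to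 \mathrm{Can}\,T^*P$ given by $$\langle\Theta(A)_\varphi,\xi_\varphi\rangle:=\langle\varphi,A(\pi^*(\varphi))\,T\pi^*(\varphi)\xi_\varphi\rangle,\qquad \xi_\varphi\in T_\varphi(T^*P),$$ is well defined (takes values in $\mathrm{Can}\,T^*P$) and bijective. (2) For $A\in\mathrm{Aut}_0TP$ let $A^*:T^*P\to T^*P$, $A^*(\varphi)=\varphi\circ A(\pi^*(\varphi))$, be its dual; it is smooth. The formula $$\langle (L^*_A\gamma)_\varphi,\xi_\varphi\rangle:=\langle\gamma_{A^*(\varphi)},TA^*(\varphi)\xi_\varphi\rangle$$ defines a left action $L^*:\mathrm{Aut}_0TP\times \mathrm{Can}\,T^*P\to \mathrm{Can}\,T^*P$, which is transitive and free. Furthermore $L^*_A\Theta(A')=\Theta(AA')$ for all $A,A'\in\mathrm{Aut}_0TP$. -/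

import Mathlib

open Bundle Set
open scoped Manifold ContDiff

noncomputable section

namespace GenCanForm

variable (E : Type*) [NormedAddCommGroup E] [NormedSpace ℝ E]
  (P : Type*) [TopologicalSpace P] [ChartedSpace E P]

/-- The cotangent bundle `T*P` (total space) of a manifold `P` modelled on `E`. -/
abbrev CotangentBundle : Type _ :=
  TotalSpace (E →L[ℝ] ℝ) (fun p : P => TangentSpace 𝓘(ℝ, E) p →L[ℝ] ℝ)

/-- The model of the manifold `T*P`, namely `E × E*`. -/
abbrev cotModel : ModelWithCorners ℝ (E × (E →L[ℝ] ℝ)) (ModelProd E (E →L[ℝ] ℝ)) :=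
  𝓘(ℝ, E).prod 𝓘(ℝ, E →L[ℝ] ℝ)

/-- The fibre product `T*P ×_P T*P`, whose points are triples `(p, φ, ψ)` with `φ, ψ ∈ T*_p P`. -/
abbrev CotangentBundleSq : Type _ :=
  TotalSpace ((E →L[ℝ] ℝ) × (E →L[ℝ] ℝ))
    ((fun p : P => TangentSpace 𝓘(ℝ, E) p →L[ℝ] ℝ) ×ᵇ
      (fun p : P => TangentSpace 𝓘(ℝ, E) p →L[ℝ] ℝ))

/-- The model of the manifold `T*P ×_P T*P`. -/
abbrev cotSqModel : ModelWithCorners ℝ (E × ((E →L[ℝ] ℝ) × (E →L[ℝ] ℝ)))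
    (ModelProd E ((E →L[ℝ] ℝ) × (E →L[ℝ] ℝ))) :=
  𝓘(ℝ, E).prod 𝓘(ℝ, (E →L[ℝ] ℝ) × (E →L[ℝ] ℝ))

variable [IsManifold 𝓘(ℝ, E) ∞ P]

/-- Smooth dependence on `p` of a family of linear maps `A(p) : T_p P → T_p P`: smoothness of the
corresponding section of the bundle `End(TP)`. -/
def SmoothEnd (A : ∀ p : P, TangentSpace 𝓘(ℝ, E) p →L[ℝ] TangentSpace 𝓘(ℝ, E) p) : Prop :=
  ContMDiff 𝓘(ℝ, E) (𝓘(ℝ, E).prod 𝓘(ℝ, E →L[ℝ] E)) ∞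
    (fun p : P => TotalSpace.mk' (E →L[ℝ] E)
      (E := fun p : P => TangentSpace 𝓘(ℝ, E) p →L[ℝ] TangentSpace 𝓘(ℝ, E) p) p (A p))

/-- All families of linear automorphisms of the tangent spaces. -/
abbrev FibreAut : Type _ :=
  ∀ p : P, TangentSpace 𝓘(ℝ, E) p ≃L[ℝ] TangentSpace 𝓘(ℝ, E) p

variable {E P}

theorem smoothEnd_iff (A : ∀ p : P, TangentSpace 𝓘(ℝ, E) p →L[ℝ] TangentSpace 𝓘(ℝ, E) p) :
    SmoothEnd E P A ↔ ∀ p₀ : P, ContMDiffAt 𝓘(ℝ, E) 𝓘(ℝ, E →L[ℝ] E) ∞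
      (fun p => ContinuousLinearMap.inCoordinates E (TangentSpace 𝓘(ℝ, E)) E
        (TangentSpace 𝓘(ℝ, E)) p₀ p p₀ p (A p)) p₀ := by
  unfold SmoothEnd
  constructor
  · intro h p₀
    exact ((contMDiffAt_hom_bundle _).1 (h p₀)).2
  · intro h p₀
    exact (contMDiffAt_hom_bundle _).2 ⟨contMDiffAt_id, h p₀⟩

theorem inCoordinates_mul {p₀ p : P} (hp : p ∈ (chartAt E p₀).source)
    (A B : TangentSpace 𝓘(ℝ, E) p →L[ℝ] TangentSpace 𝓘(ℝ, E) p) :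
    ContinuousLinearMap.inCoordinates E (TangentSpace 𝓘(ℝ, E)) E
        (TangentSpace 𝓘(ℝ, E)) p₀ p p₀ p (A.comp B) =
      (ContinuousLinearMap.inCoordinates E (TangentSpace 𝓘(ℝ, E)) E
        (TangentSpace 𝓘(ℝ, E)) p₀ p p₀ p A).comp
      (ContinuousLinearMap.inCoordinates E (TangentSpace 𝓘(ℝ, E)) E
        (TangentSpace 𝓘(ℝ, E)) p₀ p p₀ p B) := by
  have hb : p ∈ (trivializationAt E (TangentSpace 𝓘(ℝ, E)) p₀).baseSet := by simpa using hp
  ext v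
  rw [ContinuousLinearMap.inCoordinates_eq hb hb, ContinuousLinearMap.inCoordinates_eq hb hb,
    ContinuousLinearMap.inCoordinates_eq hb hb]
  simp
  have := Bundle.Trivialization.symm_apply_apply_mk
    (trivializationAt E (TangentSpace 𝓘(ℝ, E)) p₀) hb
    (B ((trivializationAt E (TangentSpace 𝓘(ℝ, E)) p₀).symm p v))
  rw [this]

theorem inCoordinates_one {p₀ p : P} (hp : p ∈ (chartAt E p₀).source) :
    ContinuousLinearMap.inCoordinates E (TangentSpace 𝓘(ℝ, E)) E
        (TangentSpace 𝓘(ℝ, E)) p₀ p p₀ p (ContinuousLinearMap.id ℝ (TangentSpace 𝓘(ℝ, E) p)) =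
      ContinuousLinearMap.id ℝ E := by
  have hb : p ∈ (trivializationAt E (TangentSpace 𝓘(ℝ, E)) p₀).baseSet := by simpa using hp
  ext v
  rw [ContinuousLinearMap.inCoordinates_eq hb hb]
  simp

theorem smoothEnd_one : SmoothEnd E P (fun _ => ContinuousLinearMap.id ℝ _) := by
  rw [smoothEnd_iff]
  intro p₀
  refine (contMDiffAt_const (c := ContinuousLinearMap.id ℝ E)).congr_of_eventuallyEq ?_
  filter_upwards [(chartAt E p₀).open_source.mem_nhds (mem_chart_source E p₀)] with p hp
  exact inCoordinates_one hp

theorem SmoothEnd.comp {A B : ∀ p : P, TangentSpace 𝓘(ℝ, E) p →L[ℝ] TangentSpace 𝓘(ℝ, E) p}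
    (hA : SmoothEnd E P A) (hB : SmoothEnd E P B) :
    SmoothEnd E P (fun p => (A p).comp (B p)) := by
  rw [smoothEnd_iff] at *
  intro p₀
  refine ((hA p₀).clm_comp (hB p₀)).congr_of_eventuallyEq ?_
  filter_upwards [(chartAt E p₀).open_source.mem_nhds (mem_chart_source E p₀)] with p hp
  exact inCoordinates_mul hp _ _

theorem SmoothEnd.symm [FiniteDimensional ℝ E] {A : FibreAut E P}
    (hA : SmoothEnd E P (fun p => (A p).toContinuousLinearMap)) :
    SmoothEnd E P (fun p => (A p).symm.toContinuousLinearMap) := by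
  have : CompleteSpace E := FiniteDimensional.complete ℝ E
  rw [smoothEnd_iff] at *
  intro p₀
  have key : ∀ p ∈ (chartAt E p₀).source, ∃ e : E ≃L[ℝ] E,
      (e : E →L[ℝ] E) = ContinuousLinearMap.inCoordinates E (TangentSpace 𝓘(ℝ, E)) E
        (TangentSpace 𝓘(ℝ, E)) p₀ p p₀ p (A p).toContinuousLinearMap ∧
      (e.symm : E →L[ℝ] E) = ContinuousLinearMap.inCoordinates E (TangentSpace 𝓘(ℝ, E)) E
        (TangentSpace 𝓘(ℝ, E)) p₀ p p₀ p (A p).symm.toContinuousLinearMap := by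
    intro p hp
    have h1 := inCoordinates_mul hp (A p).symm.toContinuousLinearMap (A p).toContinuousLinearMap
    have h2 := inCoordinates_mul hp (A p).toContinuousLinearMap (A p).symm.toContinuousLinearMap
    rw [ContinuousLinearEquiv.coe_symm_comp_coe, inCoordinates_one hp] at h1
    rw [ContinuousLinearEquiv.coe_comp_coe_symm, inCoordinates_one hp] at h2
    exact ⟨ContinuousLinearEquiv.equivOfInverse
      (ContinuousLinearMap.inCoordinates E (TangentSpace 𝓘(ℝ, E)) E
        (TangentSpace 𝓘(ℝ, E)) p₀ p p₀ p (A p).toContinuousLinearMap)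
      (ContinuousLinearMap.inCoordinates E (TangentSpace 𝓘(ℝ, E)) E
        (TangentSpace 𝓘(ℝ, E)) p₀ p p₀ p (A p).symm.toContinuousLinearMap)
      (fun x => (DFunLike.congr_fun h1 x).symm) (fun x => (DFunLike.congr_fun h2 x).symm),
      rfl, rfl⟩
  obtain ⟨e, he, -⟩ := key p₀ (mem_chart_source E p₀)
  have hinv : ContDiffAt ℝ ∞ (ContinuousLinearMap.inverse : (E →L[ℝ] E) → (E →L[ℝ] E))
      (ContinuousLinearMap.inCoordinates E (TangentSpace 𝓘(ℝ, E)) E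
        (TangentSpace 𝓘(ℝ, E)) p₀ p₀ p₀ p₀ (A p₀ : _ →L[ℝ] _)) := by
    rw [← he]
    exact contDiffAt_map_inverse e
  have hc := hinv.contMDiffAt.comp p₀ (hA p₀)
  refine hc.congr_of_eventuallyEq ?_
  filter_upwards [(chartAt E p₀).open_source.mem_nhds (mem_chart_source E p₀)] with p hp
  obtain ⟨e, he, he'⟩ := key p hp
  rw [Function.comp_apply, ← he, ← he', ContinuousLinearMap.inverse_equiv]

variable (E P)

/-- The group `Aut₀ TP` of smooth automorphisms of the tangent bundle covering the identity of `P`: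
families of linear isomorphisms `A(p) : T_p P → T_p P` depending smoothly on `p`; the product is
composition, `(A * A')(p) = A(p) ∘ A'(p)`. -/
def Aut₀ [FiniteDimensional ℝ E] : Subgroup (FibreAut E P) where
  carrier := {A | SmoothEnd E P (fun p => (A p).toContinuousLinearMap)}
  one_mem' := smoothEnd_one
  mul_mem' hA hB := SmoothEnd.comp hA hB
  inv_mem' hA := SmoothEnd.symm hA

/-- Differential one-forms on `T*P`, not necessarily smooth. -/
abbrev OneForm : Type _ :=
  ∀ φ : CotangentBundle E P, TangentSpace (cotModel E) φ →L[ℝ] ℝ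

/-- Vector fields on `T*P`, not necessarily smooth. -/
abbrev CotVectorField : Type _ := ∀ φ : CotangentBundle E P, TangentSpace (cotModel E) φ

variable {E P}

/-- Smoothness of a one-form on `T*P`, as a section of `T*(T*P)`. -/
def OneForm.Smooth (γ : OneForm E P) : Prop :=
  ContMDiff (cotModel E) ((cotModel E).prod 𝓘(ℝ, (E × (E →L[ℝ] ℝ)) →L[ℝ] ℝ)) ∞
    (fun φ : CotangentBundle E P => TotalSpace.mk' ((E × (E →L[ℝ] ℝ)) →L[ℝ] ℝ)
      (E := fun φ : CotangentBundle E P => TangentSpace (cotModel E) φ →L[ℝ] ℝ) φ (γ φ))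

variable (E P) in
/-- The projection `π* : T*P → P`. -/
def cotProj (φ : CotangentBundle E P) : P := φ.1

/-- The tangent map `Tπ*(φ) : T_φ(T*P) → T_{π*(φ)}P`. -/
def tProj (φ : CotangentBundle E P) :
    TangentSpace (cotModel E) φ →L[ℝ] TangentSpace 𝓘(ℝ, E) φ.1 :=
  mfderiv (cotModel E) 𝓘(ℝ, E) (cotProj E P) φ

/-- The projection `(p, φ, ψ) ↦ φ` of the fibre product `T*P ×_P T*P`. -/
def sqFst (z : CotangentBundleSq E P) : CotangentBundle E P := ⟨z.1, z.2.1⟩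

/-- The projection `(p, φ, ψ) ↦ ψ` of the fibre product `T*P ×_P T*P`. -/
def sqSnd (z : CotangentBundleSq E P) : CotangentBundle E P := ⟨z.1, z.2.2⟩

/-- Fibrewise addition `T*P ×_P T*P → T*P`. -/
def sqAdd (z : CotangentBundleSq E P) : CotangentBundle E P := ⟨z.1, z.2.1 + z.2.2⟩

/-- Fibrewise multiplication by the scalar `c` on `T*P`. -/
def cotSMul (c : ℝ) (φ : CotangentBundle E P) : CotangentBundle E P := ⟨φ.1, c • φ.2⟩

/-- `(ξ, χ)` is a linear vector field on `T*P`: `ξ` and `χ` are smooth vector fields on `T*P` and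
`P`, and `ξ : T*P → T(T*P)` is a morphism of vector bundles over `χ : P → TP`, where the vector
bundle structure of `Tπ* : T(T*P) → TP` is the prolonged one, i.e. its addition is the tangent map
of the addition `T*P ×_P T*P → T*P` (under the identification
`T(T*P ×_P T*P) = T(T*P) ×_{TP} T(T*P)` given by the tangent maps of the two projections) and its
multiplication by scalars is the tangent map of the multiplication by scalars on `T*P`. -/
structure IsLinearVectorField (ξ : CotVectorField E P)
    (χ : ∀ p : P, TangentSpace 𝓘(ℝ, E) p) : Prop where
  smooth : ContMDiff (cotModel E) (cotModel E).tangent ∞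
    (fun φ => (⟨φ, ξ φ⟩ : TangentBundle (cotModel E) (CotangentBundle E P)))
  smooth_base : ContMDiff 𝓘(ℝ, E) 𝓘(ℝ, E).tangent ∞
    (fun p => (⟨p, χ p⟩ : TangentBundle 𝓘(ℝ, E) P))
  proj : ∀ φ, tProj φ (ξ φ) = χ φ.1
  map_add : ∀ (z : CotangentBundleSq E P) (w : TangentSpace (cotSqModel E) z),
    mfderiv (cotSqModel E) (cotModel E) sqFst z w = ξ (sqFst z) →
    mfderiv (cotSqModel E) (cotModel E) sqSnd z w = ξ (sqSnd z) →
    mfderiv (cotSqModel E) (cotModel E) sqAdd z w = ξ (sqAdd z)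
  map_smul : ∀ (c : ℝ) (φ : CotangentBundle E P),
    mfderiv (cotModel E) (cotModel E) (cotSMul c) φ (ξ φ) = ξ (cotSMul c φ)

/-- Smooth fibrewise linear functions on `T*P`. -/
structure IsLinearFunction (f : CotangentBundle E P → ℝ) : Prop where
  smooth : ContMDiff (cotModel E) 𝓘(ℝ, ℝ) ∞ f
  linear : ∀ p : P, IsLinearMap ℝ
    (fun φ : TangentSpace 𝓘(ℝ, E) p →L[ℝ] ℝ => f ⟨p, φ⟩)

/-- Generalized canonical forms on `T*P`: smooth one-forms which do not vanish at any point off the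
zero section (they always vanish on the zero section), annihilate the vertical vectors, and are
fibrewise linear, i.e. send linear vector fields to fibrewise linear functions. -/
structure IsGenCanonical (γ : OneForm E P) : Prop where
  smooth : γ.Smooth
  ne_zero : ∀ φ : CotangentBundle E P, φ.2 ≠ 0 → γ φ ≠ 0
  semibasic : ∀ (φ : CotangentBundle E P) (v : TangentSpace (cotModel E) φ),
    tProj φ v = 0 → γ φ v = 0
  linear : ∀ (ξ : CotVectorField E P) (χ : ∀ p : P, TangentSpace 𝓘(ℝ, E) p),
    IsLinearVectorField ξ χ → IsLinearFunction (fun φ => γ φ (ξ φ))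

variable (E P) in
/-- The space `Can T*P` of generalized canonical forms on `T*P`. -/
def Can : Set (OneForm E P) := {γ | IsGenCanonical γ}

section

variable [FiniteDimensional ℝ E]

/-- `⟨Θ(A)_φ, ξ_φ⟩ = ⟨φ, A(π*(φ)) Tπ*(φ) ξ_φ⟩`. -/
def Θ (A : Aut₀ E P) : OneForm E P :=
  fun φ => φ.2.comp ((A.1 φ.1).toContinuousLinearMap.comp (tProj φ))

/-- The dual `A* : T*P → T*P` of `A ∈ Aut₀ TP`, given by `φ ↦ φ ∘ A(π*(φ))`. -/
def dual (A : Aut₀ E P) (φ : CotangentBundle E P) : CotangentBundle E P :=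
  ⟨φ.1, φ.2.comp (A.1 φ.1).toContinuousLinearMap⟩

/-- `L*_A(γ)` is the pull-back of `γ` along `A* : T*P → T*P`:
`⟨L*_A(γ)_φ, ξ_φ⟩ = ⟨γ_{A*(φ)}, TA*(φ) ξ_φ⟩`. -/
def Lstar (A : Aut₀ E P) (γ : OneForm E P) : OneForm E P :=
  fun φ => (γ (dual A φ)).comp (mfderiv (cotModel E) (cotModel E) (dual A) φ)

end

end GenCanForm

end

/-!
A one-form which annihilates the vertical vectors is `φ ↦ B(φ) ∘ Tπ*(φ)` for a unique family of
covectors `B(φ)`, and its value on a linear vector field over `χ` is `φ ↦ ⟨B(φ), χ(π*(φ))⟩`. Cutting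
off the constant horizontal fields of a chart yields linear vector fields over fields `χ` with
arbitrary prescribed values, so for a generalized canonical form `B` is linear on every fibre; it is
injective there because the form vanishes only on the zero section. By finite-dimensional duality
`B(φ) = φ ∘ A(p)` with `A(p)` invertible, and `A` is smooth because its matrix entries are values of
the form on such fields. As `π* ∘ A* = π*`, pulling back along `A*` turns `Θ(A')` into `Θ(AA')`:
the action `L*` is left multiplication of the group on itself, carried over by `Θ`.
-/

namespace GenCanForm

section TransportedAction

variable {G X : Type*} {f : G → X} {act : G → X → X}

theorem act_mem_range [Mul G] (h : ∀ a b, act a (f b) = f (a * b)) (a : G) :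
    ∀ x ∈ range f, act a x ∈ range f := by
  rintro _ ⟨b, rfl⟩
  exact ⟨a * b, (h a b).symm⟩

theorem one_act_of_mem_range [MulOneClass G] (h : ∀ a b, act a (f b) = f (a * b)) :
    ∀ x ∈ range f, act 1 x = x := by
  rintro _ ⟨b, rfl⟩
  rw [h, one_mul]

theorem mul_act_of_mem_range [Semigroup G] (h : ∀ a b, act a (f b) = f (a * b)) (a a' : G) :
    ∀ x ∈ range f, act (a * a') x = act a (act a' x) := by
  rintro _ ⟨b, rfl⟩
  simp only [h, mul_assoc]

theorem exists_act_eq_of_mem_range [Group G] (h : ∀ a b, act a (f b) = f (a * b)) :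
    ∀ x ∈ range f, ∀ y ∈ range f, ∃ a, act a x = y := by
  rintro _ ⟨b, rfl⟩ _ ⟨c, rfl⟩
  exact ⟨c * b⁻¹, by rw [h, inv_mul_cancel_right]⟩

theorem eq_one_of_act_eq_self [RightCancelMonoid G] (h : ∀ a b, act a (f b) = f (a * b))
    (hf : Function.Injective f) (a : G) : ∀ x ∈ range f, act a x = x → a = 1 := by
  rintro _ ⟨b, rfl⟩ hab
  exact mul_eq_right.1 (hf ((h a b).symm.trans hab))

end TransportedAction

section FiniteDimensional

variable {𝕜 : Type*} [NontriviallyNormedField 𝕜] [CompleteSpace 𝕜]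
  {V : Type*} [NormedAddCommGroup V] [NormedSpace 𝕜 V] [FiniteDimensional 𝕜 V]

theorem exists_continuousLinearEquiv_eq_comp (L : (V →L[𝕜] 𝕜) →ₗ[𝕜] (V →L[𝕜] 𝕜))
    (hL : Function.Injective L) : ∃ A : V ≃L[𝕜] V, ∀ φ, L φ = φ.comp (A : V →L[𝕜] V) := by
  -- `A` is the transpose of `L`, carried from the bidual to `V`.
  let toDual : Module.Dual 𝕜 V ≃ₗ[𝕜] (V →L[𝕜] 𝕜) := LinearMap.toContinuousLinearMap
  let M : Module.Dual 𝕜 V ≃ₗ[𝕜] Module.Dual 𝕜 V :=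
    toDual.trans ((LinearEquiv.ofInjectiveEndo L hL).trans toDual.symm)
  let A : V ≃ₗ[𝕜] V :=
    (Module.evalEquiv 𝕜 V).trans (M.dualMap.trans (Module.evalEquiv 𝕜 V).symm)
  have hA : ∀ (f : Module.Dual 𝕜 V) (v : V), f (A v) = M f v := fun f v =>
    Module.apply_evalEquiv_symm_apply 𝕜 V f _
  exact ⟨A.toContinuousLinearEquiv, fun φ => ContinuousLinearMap.ext fun v =>
    (hA (φ : V →ₗ[𝕜] 𝕜) v).symm⟩

variable {F : Type*} [NormedAddCommGroup F] [NormedSpace 𝕜 F]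
  {EM : Type*} [NormedAddCommGroup EM] [NormedSpace 𝕜 EM] {HM : Type*} [TopologicalSpace HM]
  {I : ModelWithCorners 𝕜 EM HM} {M : Type*} [TopologicalSpace M] [ChartedSpace HM M]
  {n : WithTop ℕ∞} {x : M}

theorem contMDiffAt_of_dual_apply {f : M → V}
    (hf : ∀ ψ : V →L[𝕜] 𝕜, ContMDiffAt I 𝓘(𝕜, 𝕜) n (fun y => ψ (f y)) x) :
    ContMDiffAt I 𝓘(𝕜, V) n f x := by
  let e : V ≃L[𝕜] (Fin (Module.finrank 𝕜 V) → 𝕜) :=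
    ContinuousLinearEquiv.ofFinrankEq (Module.finrank_fin_fun 𝕜).symm
  have he : ContMDiffAt I 𝓘(𝕜, Fin (Module.finrank 𝕜 V) → 𝕜) n (fun y => e (f y)) x :=
    contMDiffAt_pi_space.2 fun i => hf ((ContinuousLinearMap.proj i).comp e.toContinuousLinearMap)
  simpa only [Function.comp_def, e.symm_apply_apply] using
    e.symm.contDiff.contMDiff.contMDiffAt.comp x he

theorem contMDiffAt_clm_of_apply {f : M → V →L[𝕜] F}
    (hf : ∀ v, ContMDiffAt I 𝓘(𝕜, F) n (fun y => f y v) x) :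
    ContMDiffAt I 𝓘(𝕜, V →L[𝕜] F) n f x := by
  let e : V ≃L[𝕜] (Fin (Module.finrank 𝕜 V) → 𝕜) :=
    ContinuousLinearEquiv.ofFinrankEq (Module.finrank_fin_fun 𝕜).symm
  let e' : (V →L[𝕜] F) ≃L[𝕜] (Fin (Module.finrank 𝕜 V) → F) :=
    (e.arrowCongr (ContinuousLinearEquiv.refl 𝕜 F)).trans
      (ContinuousLinearEquiv.piRing (Fin (Module.finrank 𝕜 V)))
  have he : ContMDiffAt I 𝓘(𝕜, Fin (Module.finrank 𝕜 V) → F) n (fun y => e' (f y)) x :=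
    contMDiffAt_pi_space.2 fun i => hf (e.symm (Pi.single i 1))
  simpa only [Function.comp_def, e'.symm_apply_apply] using
    e'.symm.contDiff.contMDiff.contMDiffAt.comp x he

end FiniteDimensional

section InCoordinates

variable {𝕜 : Type*} [NontriviallyNormedField 𝕜]
  {B₁ : Type*} [TopologicalSpace B₁] {F₁ : Type*} [NormedAddCommGroup F₁] [NormedSpace 𝕜 F₁]
  {V₁ : B₁ → Type*} [∀ b, AddCommGroup (V₁ b)] [∀ b, Module 𝕜 (V₁ b)]
  [∀ b, TopologicalSpace (V₁ b)] [TopologicalSpace (TotalSpace F₁ V₁)]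
  [FiberBundle F₁ V₁] [VectorBundle 𝕜 F₁ V₁]
  {B₂ : Type*} [TopologicalSpace B₂] {F₂ : Type*} [NormedAddCommGroup F₂] [NormedSpace 𝕜 F₂]
  {V₂ : B₂ → Type*} [∀ b, AddCommGroup (V₂ b)] [∀ b, Module 𝕜 (V₂ b)]
  [∀ b, TopologicalSpace (V₂ b)] [TopologicalSpace (TotalSpace F₂ V₂)]
  [FiberBundle F₂ V₂] [VectorBundle 𝕜 F₂ V₂]
  {B₃ : Type*} [TopologicalSpace B₃] {F₃ : Type*} [NormedAddCommGroup F₃] [NormedSpace 𝕜 F₃]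
  {V₃ : B₃ → Type*} [∀ b, AddCommGroup (V₃ b)] [∀ b, Module 𝕜 (V₃ b)]
  [∀ b, TopologicalSpace (V₃ b)] [TopologicalSpace (TotalSpace F₃ V₃)]
  [FiberBundle F₃ V₃] [VectorBundle 𝕜 F₃ V₃]

theorem inCoordinates_comp {y₀ y : B₂} (hy : y ∈ (trivializationAt F₂ V₂ y₀).baseSet)
    (x₀ x : B₁) (z₀ z : B₃) (ψ : V₂ y →L[𝕜] V₃ z) (φ : V₁ x →L[𝕜] V₂ y) :
    ContinuousLinearMap.inCoordinates F₁ V₁ F₃ V₃ x₀ x z₀ z (ψ.comp φ) =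
      (ContinuousLinearMap.inCoordinates F₂ V₂ F₃ V₃ y₀ y z₀ z ψ).comp
        (ContinuousLinearMap.inCoordinates F₁ V₁ F₂ V₂ x₀ x y₀ y φ) := by
  ext v
  simp only [ContinuousLinearMap.inCoordinates, ContinuousLinearMap.comp_apply,
    (trivializationAt F₂ V₂ y₀).symmL_continuousLinearMapAt hy]

end InCoordinates

section VectorBundle

variable {𝕜 : Type*} [NontriviallyNormedField 𝕜]
  {EB : Type*} [NormedAddCommGroup EB] [NormedSpace 𝕜 EB] {HB : Type*} [TopologicalSpace HB]
  {IB : ModelWithCorners 𝕜 EB HB} {B : Type*} [TopologicalSpace B] [ChartedSpace HB B]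
  {F : Type*} [NormedAddCommGroup F] [NormedSpace 𝕜 F]
  {V : B → Type*} [∀ b, TopologicalSpace (V b)] [TopologicalSpace (TotalSpace F V)]
  [FiberBundle F V]
  {EM : Type*} [NormedAddCommGroup EM] [NormedSpace 𝕜 EM] {HM : Type*} [TopologicalSpace HM]
  {I : ModelWithCorners 𝕜 EM HM} {M : Type*} [TopologicalSpace M] [ChartedSpace HM M]
  {m : M}

theorem mfderiv_proj_mfderiv {f : M → TotalSpace F V} (hf : MDiffAt f m) (w : TangentSpace I m) :
    mfderiv% (π F V) (f m) (mfderiv% f m w) = mfderiv% (fun m => (f m).1) m w :=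
  (mfderiv_comp_apply m (mdifferentiableAt_proj V) hf w).symm

variable [∀ b, AddCommGroup (V b)] [∀ b, Module 𝕜 (V b)] [VectorBundle 𝕜 F V]

theorem contMDiffOn_symmL_section {n : WithTop ℕ∞} [ContMDiffVectorBundle n F V IB]
    (e : Trivialization F (π F V)) [MemTrivializationAtlas e] (v : F) :
    ContMDiffOn IB (IB.prod 𝓘(𝕜, F)) n
      (fun b => TotalSpace.mk' F b (e.symmL 𝕜 b v)) e.baseSet := by
  refine e.contMDiffOn_section_baseSet_iff.2 (contMDiffOn_const (c := v) |>.congr fun b hb => ?_)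
  rw [e.symmL_apply hb, e.apply_mk_symm hb]

variable {b : M → B} {s t : ∀ m, V (b m)}

theorem mdifferentiableAt_totalSpace_add
    (hs : MDiffAt (fun m => TotalSpace.mk' F (b m) (s m)) m)
    (ht : MDiffAt (fun m => TotalSpace.mk' F (b m) (t m)) m) :
    MDiffAt (fun m => TotalSpace.mk' F (b m) (s m + t m)) m := by
  rw [mdifferentiableAt_totalSpace] at hs ht ⊢
  refine ⟨hs.1, (hs.2.add ht.2).congr_of_eventuallyEq ?_⟩
  filter_upwards [hs.1.continuousAt.preimage_mem_nhds
    ((trivializationAt F V (b m)).open_baseSet.mem_nhds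
      (FiberBundle.mem_baseSet_trivializationAt' (b m)))] with m' hm'
  exact ((trivializationAt F V (b m)).linear 𝕜 hm').map_add _ _

theorem mdifferentiableAt_totalSpace_const_smul (c : 𝕜)
    (hs : MDiffAt (fun m => TotalSpace.mk' F (b m) (s m)) m) :
    MDiffAt (fun m => TotalSpace.mk' F (b m) (c • s m)) m := by
  rw [mdifferentiableAt_totalSpace] at hs ⊢
  refine ⟨hs.1, (hs.2.const_smul c).congr_of_eventuallyEq ?_⟩
  filter_upwards [hs.1.continuousAt.preimage_mem_nhds
    ((trivializationAt F V (b m)).open_baseSet.mem_nhds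
      (FiberBundle.mem_baseSet_trivializationAt' (b m)))] with m' hm'
  exact ((trivializationAt F V (b m)).linear 𝕜 hm').map_smul _ _

/-- The fibre coordinate of a trivialization `e`. Together with the projection to the base, its
differential determines a tangent vector of the total space. -/
def fiberCoord (e : Trivialization F (π F V)) (y : TotalSpace F V) : F := (e y).2

variable [ContMDiffVectorBundle 1 F V IB] {e : Trivialization F (π F V)} [MemTrivializationAtlas e]

theorem mdifferentiableAt_fiberCoord {y : TotalSpace F V} (hy : y.1 ∈ e.baseSet) :
    MDiffAt (fiberCoord e) y :=
  ((e.mdifferentiableAt_totalSpace_iff IB id (e.mem_source.2 hy)).1 mdifferentiableAt_id).2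

theorem eq_of_mfderiv_proj_eq_of_mvfderiv_fiberCoord_eq {y : TotalSpace F V}
    (hy : y.1 ∈ e.baseSet) {w w' : TangentSpace (IB.prod 𝓘(𝕜, F)) y}
    (hproj : mfderiv% (π F V) y w = mfderiv% (π F V) y w')
    (hfiber : d% (fiberCoord e) y w = d% (fiberCoord e) y w') : w = w' := by
  have hys : y ∈ e.source := e.mem_source.2 hy
  have he : (fun z => (z.proj, fiberCoord e z)) =ᶠ[nhds y] e.toOpenPartialHomeomorph :=
    Filter.eventuallyEq_of_mem (e.open_source.mem_nhds hys) fun _ hz => e.mk_proj_snd hz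
  apply (e.mdifferentiable (I := IB)).mfderiv_injective hys
  rw [← he.mfderiv_eq, mfderiv_prodMk (mdifferentiableAt_proj V) (mdifferentiableAt_fiberCoord hy)]
  exact Prod.ext hproj hfiber

theorem mvfderiv_fiberCoord_mfderiv {f : M → TotalSpace F V} (hf : MDiffAt f m)
    (hm : (f m).1 ∈ e.baseSet) (w : TangentSpace I m) :
    d% (fiberCoord e) (f m) (mfderiv% f m w) = d% (fiberCoord e ∘ f) m w :=
  (mfderiv_comp_apply m (mdifferentiableAt_fiberCoord hm) hf w).symm

theorem mvfderiv_fiberCoord_add (hm : b m ∈ e.baseSet)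
    (hs : MDiffAt (fun m => TotalSpace.mk' F (b m) (s m)) m)
    (ht : MDiffAt (fun m => TotalSpace.mk' F (b m) (t m)) m) (w : TangentSpace I m) :
    d% (fiberCoord e) ⟨b m, s m + t m⟩
        (mfderiv% (fun m => TotalSpace.mk' F (b m) (s m + t m)) m w) =
      d% (fiberCoord e) ⟨b m, s m⟩ (mfderiv% (fun m => TotalSpace.mk' F (b m) (s m)) m w) +
      d% (fiberCoord e) ⟨b m, t m⟩ (mfderiv% (fun m => TotalSpace.mk' F (b m) (t m)) m w) := by
  have hadd : (fiberCoord e ∘ fun m => TotalSpace.mk' F (b m) (s m + t m)) =ᶠ[nhds m]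
      (fiberCoord e ∘ fun m => TotalSpace.mk' F (b m) (s m)) +
        (fiberCoord e ∘ fun m => TotalSpace.mk' F (b m) (t m)) := by
    filter_upwards [((mdifferentiableAt_totalSpace _ _).1 hs).1.continuousAt.preimage_mem_nhds
      (e.open_baseSet.mem_nhds hm)] with m' hm'
    exact (e.linear 𝕜 hm').map_add _ _
  refine (mvfderiv_fiberCoord_mfderiv (mdifferentiableAt_totalSpace_add hs ht) hm w).trans
    (Eq.trans ?_ (congrArg₂ (· + ·) (mvfderiv_fiberCoord_mfderiv hs hm w).symm
      (mvfderiv_fiberCoord_mfderiv ht hm w).symm))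
  rw [mvfderiv, hadd.mfderiv_eq]
  exact DFunLike.congr_fun (mvfderiv_add ((mdifferentiableAt_fiberCoord hm).comp m hs)
    ((mdifferentiableAt_fiberCoord hm).comp m ht)) w

theorem mvfderiv_fiberCoord_const_smul {y : TotalSpace F V} (hy : y.1 ∈ e.baseSet) (c : 𝕜)
    (w : TangentSpace (IB.prod 𝓘(𝕜, F)) y) :
    d% (fiberCoord e) ⟨y.1, c • y.2⟩
        (mfderiv% (fun y : TotalSpace F V => TotalSpace.mk' F y.1 (c • y.2)) y w) =
      c • d% (fiberCoord e) y w := by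
  have hsmul : (fiberCoord e ∘ fun y : TotalSpace F V => TotalSpace.mk' F y.1 (c • y.2)) =ᶠ[nhds y]
      c • fiberCoord e := by
    filter_upwards [e.open_source.mem_nhds (e.mem_source.2 hy)] with y' hy'
    exact (e.linear 𝕜 (e.mem_source.1 hy')).map_smul _ _
  refine (mvfderiv_fiberCoord_mfderiv
    (mdifferentiableAt_totalSpace_const_smul c mdifferentiableAt_id) hy w).trans ?_
  rw [mvfderiv, hsmul.mfderiv_eq]
  exact DFunLike.congr_fun (const_smul_mfderiv (mdifferentiableAt_fiberCoord hy) c) w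

end VectorBundle

section DirectSum

variable {𝕜 : Type*} [NontriviallyNormedField 𝕜]
  {EB : Type*} [NormedAddCommGroup EB] [NormedSpace 𝕜 EB] {HB : Type*} [TopologicalSpace HB]
  {IB : ModelWithCorners 𝕜 EB HB} {B : Type*} [TopologicalSpace B] [ChartedSpace HB B]
  {F₁ : Type*} [NormedAddCommGroup F₁] [NormedSpace 𝕜 F₁]
  {V₁ : B → Type*} [∀ b, Zero (V₁ b)] [∀ b, TopologicalSpace (V₁ b)]
  [TopologicalSpace (TotalSpace F₁ V₁)] [FiberBundle F₁ V₁]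
  {F₂ : Type*} [NormedAddCommGroup F₂] [NormedSpace 𝕜 F₂]
  {V₂ : B → Type*} [∀ b, Zero (V₂ b)] [∀ b, TopologicalSpace (V₂ b)]
  [TopologicalSpace (TotalSpace F₂ V₂)] [FiberBundle F₂ V₂]
  {n : WithTop ℕ∞}

theorem contMDiff_directSum_fst :
    ContMDiff (IB.prod 𝓘(𝕜, F₁ × F₂)) (IB.prod 𝓘(𝕜, F₁)) n
      (fun z : TotalSpace (F₁ × F₂) (V₁ ×ᵇ V₂) => TotalSpace.mk' F₁ z.1 z.2.1) := fun z =>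
  have hz := contMDiffAt_totalSpace.1 (contMDiffAt_id (I := IB.prod 𝓘(𝕜, F₁ × F₂)) (x := z))
  contMDiffAt_totalSpace.2
    ⟨hz.1, (ContinuousLinearMap.fst 𝕜 F₁ F₂).contMDiff.contMDiffAt.comp z hz.2⟩

theorem contMDiff_directSum_snd :
    ContMDiff (IB.prod 𝓘(𝕜, F₁ × F₂)) (IB.prod 𝓘(𝕜, F₂)) n
      (fun z : TotalSpace (F₁ × F₂) (V₁ ×ᵇ V₂) => TotalSpace.mk' F₂ z.1 z.2.2) := fun z =>
  have hz := contMDiffAt_totalSpace.1 (contMDiffAt_id (I := IB.prod 𝓘(𝕜, F₁ × F₂)) (x := z))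
  contMDiffAt_totalSpace.2
    ⟨hz.1, (ContinuousLinearMap.snd 𝕜 F₁ F₂).contMDiff.contMDiffAt.comp z hz.2⟩

end DirectSum

section ChartFields

variable {𝕜 : Type*} [NontriviallyNormedField 𝕜]
  {EB : Type*} [NormedAddCommGroup EB] [NormedSpace 𝕜 EB] {HB : Type*} [TopologicalSpace HB]
  {IB : ModelWithCorners 𝕜 EB HB} {B : Type*} [TopologicalSpace B] [ChartedSpace HB B]
  {F : Type*} [NormedAddCommGroup F] [NormedSpace 𝕜 F]
  {V : B → Type*} [∀ b, TopologicalSpace (V b)] [TopologicalSpace (TotalSpace F V)]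

theorem mem_chartAt_source_totalSpace [∀ b, Zero (V b)] [FiberBundle F V] {y₀ y : TotalSpace F V} :
    y ∈ (chartAt (ModelProd HB F) y₀).source ↔
      y.1 ∈ (chartAt HB y₀.1).source ∧ y.1 ∈ (trivializationAt F V y₀.1).baseSet := by
  simp only [FiberBundle.chartedSpace_chartAt, mfld_simps]
  rw [and_comm, Trivialization.mem_source]
  exact and_congr_left fun hy => iff_of_eq (congrArg (· ∈ _) (Trivialization.coe_fst' _ hy))

variable [IsManifold IB 1 B]

theorem mfderiv_extChartAt_symmL {x₀ x : B} (hx : x ∈ (chartAt HB x₀).source) (u : EB) :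
    mfderiv% (extChartAt IB x₀) x
      ((trivializationAt EB (TangentSpace IB) x₀).symmL 𝕜 x u) = u := by
  rw [← TangentBundle.continuousLinearMapAt_trivializationAt hx]
  exact (trivializationAt EB (TangentSpace IB) x₀).continuousLinearMapAt_symmL (by simpa using hx) u

variable [∀ b, AddCommGroup (V b)] [∀ b, Module 𝕜 (V b)]
  [FiberBundle F V] [VectorBundle 𝕜 F V] [ContMDiffVectorBundle 1 F V IB]
  {y₀ y : TotalSpace F V}

theorem mfderiv_extChartAt_totalSpace (hy : y.1 ∈ (chartAt HB y₀.1).source)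
    (hy' : y.1 ∈ (trivializationAt F V y₀.1).baseSet) (w : TangentSpace (IB.prod 𝓘(𝕜, F)) y) :
    mfderiv (IB.prod 𝓘(𝕜, F)) 𝓘(𝕜, EB × F) (extChartAt (IB.prod 𝓘(𝕜, F)) y₀) y w =
      (mfderiv% (extChartAt IB y₀.1) y.1 (mfderiv% (π F V) y w),
        d% (fiberCoord (trivializationAt F V y₀.1)) y w) := by
  have hchart : (fun z => (extChartAt IB y₀.1 z.proj, fiberCoord (trivializationAt F V y₀.1) z))
      =ᶠ[nhds y] extChartAt (IB.prod 𝓘(𝕜, F)) y₀ := by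
    filter_upwards [(trivializationAt F V y₀.1).open_source.mem_nhds
      ((trivializationAt F V y₀.1).mem_source.2 hy')] with z hz
    rw [FiberBundle.extChartAt]
    simp [fiberCoord, Trivialization.coe_fst _ hz]
  have hbase := mdifferentiableAt_extChartAt (I := IB) hy
  have hderiv : mfderiv (IB.prod 𝓘(𝕜, F)) 𝓘(𝕜, EB × F)
      (fun z => (extChartAt IB y₀.1 z.proj, fiberCoord (trivializationAt F V y₀.1) z)) y =
      (mfderiv% (extChartAt IB y₀.1 ∘ π F V) y).prod
        (mfderiv% (fiberCoord (trivializationAt F V y₀.1)) y) := by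
    rw [modelWithCornersSelf_prod, ← chartedSpaceSelf_prod]
    exact mfderiv_prodMk (hbase.comp y (mdifferentiableAt_proj V))
      (mdifferentiableAt_fiberCoord (IB := IB) hy')
  refine (DFunLike.congr_fun (hchart.mfderiv_eq.symm.trans hderiv) w).trans ?_
  exact Prod.ext (mfderiv_comp_apply y hbase (mdifferentiableAt_proj V) w) rfl

theorem mfderiv_proj_symmL (hy : y.1 ∈ (chartAt HB y₀.1).source)
    (hy' : y.1 ∈ (trivializationAt F V y₀.1).baseSet) (u : EB × F) :
    mfderiv% (π F V) y
      ((trivializationAt (EB × F) (TangentSpace (IB.prod 𝓘(𝕜, F))) y₀).symmL 𝕜 y u) =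
      (trivializationAt EB (TangentSpace IB) y₀.1).symmL 𝕜 y.1 u.1 := by
  have h := mfderiv_extChartAt_totalSpace hy hy'
    ((trivializationAt (EB × F) (TangentSpace (IB.prod 𝓘(𝕜, F))) y₀).symmL 𝕜 y u)
  rw [mfderiv_extChartAt_symmL (mem_chartAt_source_totalSpace.2 ⟨hy, hy'⟩),
    ← TangentBundle.continuousLinearMapAt_trivializationAt hy] at h
  refine ((trivializationAt EB (TangentSpace IB) y₀.1).symmL_continuousLinearMapAt
    (R := 𝕜) (by simpa using hy) _).symm.trans ?_
  exact congrArg _ (congrArg Prod.fst h).symm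

theorem mvfderiv_fiberCoord_symmL (hy : y.1 ∈ (chartAt HB y₀.1).source)
    (hy' : y.1 ∈ (trivializationAt F V y₀.1).baseSet) (u : EB × F) :
    d% (fiberCoord (trivializationAt F V y₀.1)) y
      ((trivializationAt (EB × F) (TangentSpace (IB.prod 𝓘(𝕜, F))) y₀).symmL 𝕜 y u) = u.2 := by
  have h := mfderiv_extChartAt_totalSpace hy hy'
    ((trivializationAt (EB × F) (TangentSpace (IB.prod 𝓘(𝕜, F))) y₀).symmL 𝕜 y u)
  rw [mfderiv_extChartAt_symmL (mem_chartAt_source_totalSpace.2 ⟨hy, hy'⟩)] at h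
  exact (congrArg Prod.snd h).symm

end ChartFields

variable {E : Type*} [NormedAddCommGroup E] [NormedSpace ℝ E]
  {P : Type*} [TopologicalSpace P] [ChartedSpace E P] [IsManifold 𝓘(ℝ, E) ∞ P]

section LinearVectorFields

variable (E) in
/-- The coordinate `T*P → E*` along the fibres which belongs to the chart of `P` at `p₀`. -/
noncomputable def momentum (p₀ : P) : CotangentBundle E P → E →L[ℝ] ℝ :=
  fiberCoord (trivializationAt (E →L[ℝ] ℝ) (fun p : P => TangentSpace 𝓘(ℝ, E) p →L[ℝ] ℝ) p₀)

theorem isLinearVectorField_of_isLinearMap_momentum {ξ : CotVectorField E P}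
    {χ : ∀ p : P, TangentSpace 𝓘(ℝ, E) p}
    (smooth : ContMDiff (cotModel E) (cotModel E).tangent ∞
      (fun φ => (⟨φ, ξ φ⟩ : TangentBundle (cotModel E) (CotangentBundle E P))))
    (smooth_base : ContMDiff 𝓘(ℝ, E) 𝓘(ℝ, E).tangent ∞
      (fun p => (⟨p, χ p⟩ : TangentBundle 𝓘(ℝ, E) P)))
    (proj : ∀ φ, tProj φ (ξ φ) = χ φ.1)
    (linear : ∀ p, ∃ p₀ : P, p ∈ (chartAt E p₀).source ∧
      IsLinearMap ℝ (fun φ : TangentSpace 𝓘(ℝ, E) p →L[ℝ] ℝ =>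
        mvfderiv (cotModel E) (momentum E p₀) ⟨p, φ⟩ (ξ ⟨p, φ⟩))) :
    IsLinearVectorField ξ χ where
  smooth := smooth
  smooth_base := smooth_base
  proj := proj
  map_add z w hfst hsnd := by
    obtain ⟨p₀, hp₀, hlin⟩ := linear z.1
    have hb : z.1 ∈ (trivializationAt (E →L[ℝ] ℝ)
      (fun p : P => TangentSpace 𝓘(ℝ, E) p →L[ℝ] ℝ) p₀).baseSet := by simpa using hp₀
    have hdfst := (contMDiff_directSum_fst (IB := 𝓘(ℝ, E)) (n := 1) z).mdifferentiableAt one_ne_zero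
    have hdsnd := (contMDiff_directSum_snd (IB := 𝓘(ℝ, E)) (n := 1) z).mdifferentiableAt one_ne_zero
    have hproj : tProj (sqAdd z) (mfderiv (cotSqModel E) (cotModel E) sqAdd z w) =
        tProj (sqFst z) (mfderiv (cotSqModel E) (cotModel E) sqFst z w) :=
      (mfderiv_proj_mfderiv (mdifferentiableAt_totalSpace_add hdfst hdsnd) w).trans
        (mfderiv_proj_mfderiv hdfst w).symm
    refine eq_of_mfderiv_proj_eq_of_mvfderiv_fiberCoord_eq hb ?_ ?_
    · rw [hfst, proj] at hproj
      exact hproj.trans (proj (sqAdd z)).symm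
    · refine (mvfderiv_fiberCoord_add hb hdfst hdsnd w).trans
        (Eq.trans ?_ (hlin.map_add z.2.1 z.2.2).symm)
      exact congrArg₂ _ (congrArg _ hfst) (congrArg _ hsnd)
  map_smul c φ := by
    obtain ⟨p₀, hp₀, hlin⟩ := linear φ.1
    have hb : φ.1 ∈ (trivializationAt (E →L[ℝ] ℝ)
      (fun p : P => TangentSpace 𝓘(ℝ, E) p →L[ℝ] ℝ) p₀).baseSet := by simpa using hp₀
    have hproj : tProj (cotSMul c φ) (mfderiv (cotModel E) (cotModel E) (cotSMul c) φ (ξ φ)) =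
        tProj φ (ξ φ) :=
      mfderiv_proj_mfderiv (mdifferentiableAt_totalSpace_const_smul (IB := 𝓘(ℝ, E)) c
        mdifferentiableAt_id) (ξ φ)
    refine eq_of_mfderiv_proj_eq_of_mvfderiv_fiberCoord_eq (IB := 𝓘(ℝ, E))
      (y := cotSMul c φ) hb ?_ ?_
    · exact hproj.trans ((proj φ).trans (proj (cotSMul c φ)).symm)
    · exact (mvfderiv_fiberCoord_const_smul (IB := 𝓘(ℝ, E)) hb c (ξ φ)).trans
        (hlin.map_smul c φ.2).symm


theorem mem_chartAt_source_cotangent {φ₀ φ : CotangentBundle E P} :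
    φ ∈ (chartAt (ModelProd E (E →L[ℝ] ℝ)) φ₀).source ↔ φ.1 ∈ (chartAt E φ₀.1).source := by
  simp [mem_chartAt_source_totalSpace]

/-- The vector field on `T*P` which is constantly `(v, 0)` in the chart belonging to the chart of
`P` at `p₀`; it has junk values outside the domain of that chart. -/
noncomputable def horizontalField (p₀ : P) (v : E) : CotVectorField E P := fun φ =>
  (trivializationAt (E × (E →L[ℝ] ℝ)) (TangentSpace (cotModel E))
    (⟨p₀, 0⟩ : CotangentBundle E P)).symmL ℝ φ (v, 0)

theorem tProj_horizontalField {p₀ : P} (v : E) {φ : CotangentBundle E P}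
    (hφ : φ.1 ∈ (chartAt E p₀).source) :
    tProj φ (horizontalField p₀ v φ) =
      (trivializationAt E (TangentSpace 𝓘(ℝ, E)) p₀).symmL ℝ φ.1 v :=
  mfderiv_proj_symmL hφ (by simpa using hφ) (v, 0)

theorem mvfderiv_momentum_horizontalField {p₀ : P} (v : E) {φ : CotangentBundle E P}
    (hφ : φ.1 ∈ (chartAt E p₀).source) :
    mvfderiv (cotModel E) (momentum E p₀) φ (horizontalField p₀ v φ) = 0 :=
  mvfderiv_fiberCoord_symmL (IB := 𝓘(ℝ, E)) (y₀ := (⟨p₀, 0⟩ : CotangentBundle E P)) hφ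
    (by simpa using hφ) (v, 0)

theorem isLinearVectorField_smul_horizontalField (p₀ : P) (v : E) {f : P → ℝ}
    (hf : ContMDiff 𝓘(ℝ, E) 𝓘(ℝ, ℝ) ∞ f) (hsupp : tsupport f ⊆ (chartAt E p₀).source) :
    IsLinearVectorField (fun φ : CotangentBundle E P => f φ.1 • horizontalField p₀ v φ)
      (fun p => f p • (trivializationAt E (TangentSpace 𝓘(ℝ, E)) p₀).symmL ℝ p v) := by
  have hzero : ∀ p ∉ (chartAt E p₀).source, f p = 0 := fun p hp =>
    image_eq_zero_of_notMem_tsupport fun h => hp (hsupp h)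
  have hproj : ContMDiff (cotModel E) 𝓘(ℝ, E) ∞ (cotProj E P) := contMDiff_proj _
  refine isLinearVectorField_of_isLinearMap_momentum ?_ ?_ (fun φ => ?_) (fun p => ?_)
  · refine ContMDiffOn.smul_section_of_tsupport (ψ := f ∘ cotProj E P) (hf.comp hproj).contMDiffOn
      (Trivialization.open_baseSet _) (fun φ hφ => ?_) (contMDiffOn_symmL_section _ (v, 0))
    rw [TangentBundle.trivializationAt_baseSet, mem_chartAt_source_cotangent]
    exact hsupp (tsupport_comp_subset_preimage f hproj.continuous hφ)
  · refine ContMDiffOn.smul_section_of_tsupport hf.contMDiffOn (Trivialization.open_baseSet _)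
      ?_ (contMDiffOn_symmL_section _ v)
    rwa [TangentBundle.trivializationAt_baseSet]
  · rw [(tProj φ).map_smul]
    by_cases hφ : φ.1 ∈ (chartAt E p₀).source
    · rw [tProj_horizontalField v hφ]
    · rw [hzero _ hφ, zero_smul, zero_smul]
  · obtain ⟨p₁, hp₁, hvanish⟩ : ∃ p₁ : P, p ∈ (chartAt E p₁).source ∧
        ∀ φ : TangentSpace 𝓘(ℝ, E) p →L[ℝ] ℝ, mvfderiv (cotModel E) (momentum E p₁) ⟨p, φ⟩
          (f p • horizontalField p₀ v ⟨p, φ⟩) = 0 := by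
      by_cases hp : p ∈ (chartAt E p₀).source
      · refine ⟨p₀, hp, fun φ => ?_⟩
        rw [ContinuousLinearMap.map_smul,
          mvfderiv_momentum_horizontalField (φ := ⟨p, φ⟩) v hp, smul_zero]
      · refine ⟨p, mem_chart_source E p, fun φ => ?_⟩
        rw [hzero p hp, zero_smul, ContinuousLinearMap.map_zero]
    refine ⟨p₁, hp₁, ?_⟩
    simp only [hvanish]
    exact LinearMap.isLinear 0

theorem exists_isLinearVectorField [FiniteDimensional ℝ E] [T2Space P] (p₀ : P) (v : E) :
    ∃ (ξ : CotVectorField E P) (χ : ∀ p : P, TangentSpace 𝓘(ℝ, E) p),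
      IsLinearVectorField ξ χ ∧ ∀ᶠ p in nhds p₀,
        χ p = (trivializationAt E (TangentSpace 𝓘(ℝ, E)) p₀).symmL ℝ p v := by
  obtain ⟨f⟩ : Nonempty (SmoothBumpFunction 𝓘(ℝ, E) p₀) := inferInstance
  refine ⟨_, _, isLinearVectorField_smul_horizontalField p₀ v f.contMDiff
    f.tsupport_subset_chartAt_source, ?_⟩
  filter_upwards [f.eventuallyEq_one] with p hp
  simp [hp]

end LinearVectorFields

section SemibasicForms

/-- The one-form `φ ↦ B(φ) ∘ Tπ*(φ)` on `T*P` given by a covector `B(φ)` of `P` at `π*(φ)` for each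
`φ`. -/
noncomputable def semibasicForm
    (B : ∀ φ : CotangentBundle E P, TangentSpace 𝓘(ℝ, E) φ.1 →L[ℝ] ℝ) : OneForm E P :=
  fun φ => (B φ).comp (tProj φ)

theorem exists_tProj_comp_eq_id (φ : CotangentBundle E P) :
    ∃ R : TangentSpace 𝓘(ℝ, E) φ.1 →L[ℝ] TangentSpace (cotModel E) φ,
      (tProj φ).comp R = ContinuousLinearMap.id ℝ _ := by
  refine ⟨((trivializationAt (E × (E →L[ℝ] ℝ)) (TangentSpace (cotModel E))
    (⟨φ.1, 0⟩ : CotangentBundle E P)).symmL ℝ φ).comp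
      ((ContinuousLinearMap.inl ℝ E (E →L[ℝ] ℝ)).comp
        ((trivializationAt E (TangentSpace 𝓘(ℝ, E)) φ.1).continuousLinearMapAt ℝ φ.1)),
    ContinuousLinearMap.ext fun v => ?_⟩
  refine (tProj_horizontalField _ (mem_chart_source E φ.1)).trans ?_
  exact Trivialization.symmL_continuousLinearMapAt _
    (FiberBundle.mem_baseSet_trivializationAt' φ.1) v

theorem comp_tProj_injective (φ : CotangentBundle E P) :
    Function.Injective fun β : TangentSpace 𝓘(ℝ, E) φ.1 →L[ℝ] ℝ => β.comp (tProj φ) := by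
  intro β β' h
  obtain ⟨R, hR⟩ := exists_tProj_comp_eq_id φ
  have hcomp : β.comp ((tProj φ).comp R) = β'.comp ((tProj φ).comp R) :=
    congrArg (ContinuousLinearMap.comp · R) h
  rwa [hR, ContinuousLinearMap.comp_id, ContinuousLinearMap.comp_id] at hcomp

theorem exists_semibasicForm_eq {γ : OneForm E P}
    (hγ : ∀ (φ : CotangentBundle E P) (v : TangentSpace (cotModel E) φ),
      tProj φ v = 0 → γ φ v = 0) : ∃ B, semibasicForm B = γ := by
  choose R hR using exists_tProj_comp_eq_id (E := E) (P := P)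
  refine ⟨fun φ => (γ φ).comp (R φ), funext fun φ => ContinuousLinearMap.ext fun w => ?_⟩
  refine sub_eq_zero.1 (((γ φ).map_sub _ w).symm.trans (hγ φ _ ?_))
  refine ((tProj φ).map_sub _ w).trans (sub_eq_zero.2 ?_)
  exact DFunLike.congr_fun (hR φ) (tProj φ w)

variable {B : ∀ φ : CotangentBundle E P, TangentSpace 𝓘(ℝ, E) φ.1 →L[ℝ] ℝ}

theorem smooth_semibasicForm
    (hB : ContMDiff (cotModel E) (cotModel E) ∞
      (fun φ => (⟨φ.1, B φ⟩ : CotangentBundle E P))) : (semibasicForm B).Smooth := by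
  intro φ₀
  have hproj : ContMDiff (cotModel E) 𝓘(ℝ, E) ∞ (cotProj E P) := contMDiff_proj _
  refine (contMDiffAt_hom_bundle _).2 ⟨contMDiffAt_id, ?_⟩
  refine (((contMDiffAt_hom_bundle _).1 (hB φ₀)).2.clm_comp
    ((hproj φ₀).mfderiv_const le_rfl)).congr_of_eventuallyEq ?_
  filter_upwards [(hproj φ₀).continuousAt.preimage_mem_nhds
    ((trivializationAt E (TangentSpace 𝓘(ℝ, E)) φ₀.1).open_baseSet.mem_nhds
      (FiberBundle.mem_baseSet_trivializationAt' φ₀.1))] with φ hφ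
  exact inCoordinates_comp hφ _ _ _ _ _ _

theorem OneForm.Smooth.contMDiff_apply {γ : OneForm E P} (hγ : γ.Smooth) {ξ : CotVectorField E P}
    (hξ : ContMDiff (cotModel E) (cotModel E).tangent ∞
      (fun φ => (⟨φ, ξ φ⟩ : TangentBundle (cotModel E) (CotangentBundle E P)))) :
    ContMDiff (cotModel E) 𝓘(ℝ, ℝ) ∞ (fun φ => γ φ (ξ φ)) := fun φ =>
  (contMDiffAt_totalSpace.1 (ContMDiffAt.clm_bundle_apply
    (E₂ := Bundle.Trivial (CotangentBundle E P) ℝ) (F₂ := ℝ) (hγ φ) (hξ φ))).2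

theorem IsLinearVectorField.semibasicForm_apply {ξ : CotVectorField E P}
    {χ : ∀ p : P, TangentSpace 𝓘(ℝ, E) p} (hξ : IsLinearVectorField ξ χ)
    (φ : CotangentBundle E P) : semibasicForm B φ (ξ φ) = B φ (χ φ.1) :=
  congrArg (B φ) (hξ.proj φ)

theorem isGenCanonical_semibasicForm
    (smooth : ContMDiff (cotModel E) (cotModel E) ∞ (fun φ => (⟨φ.1, B φ⟩ : CotangentBundle E P)))
    (ne_zero : ∀ φ : CotangentBundle E P, φ.2 ≠ 0 → B φ ≠ 0)
    (linear : ∀ (p : P) (v : TangentSpace 𝓘(ℝ, E) p), IsLinearMap ℝ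
      fun φ : TangentSpace 𝓘(ℝ, E) p →L[ℝ] ℝ => B ⟨p, φ⟩ v) :
    IsGenCanonical (semibasicForm B) where
  smooth := smooth_semibasicForm smooth
  ne_zero φ hφ h := ne_zero φ hφ
    (comp_tProj_injective φ (h.trans (ContinuousLinearMap.zero_comp _).symm))
  semibasic φ v hv := (congrArg (B φ) hv).trans (B φ).map_zero
  linear ξ χ hξ :=
    { smooth := (smooth_semibasicForm smooth).contMDiff_apply hξ.smooth
      linear := fun p => by
        simp only [hξ.semibasicForm_apply]
        exact linear p (χ p) }

end SemibasicForms

section Theta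

theorem SmoothEnd.contMDiff_comp
    {A : ∀ p : P, TangentSpace 𝓘(ℝ, E) p →L[ℝ] TangentSpace 𝓘(ℝ, E) p} (hA : SmoothEnd E P A) :
    ContMDiff (cotModel E) (cotModel E) ∞
      (fun φ : CotangentBundle E P => (⟨φ.1, φ.2.comp (A φ.1)⟩ : CotangentBundle E P)) := by
  intro φ₀
  have hproj : ContMDiff (cotModel E) 𝓘(ℝ, E) ∞ (cotProj E P) := contMDiff_proj _
  have hid := (contMDiffAt_hom_bundle _).1 (contMDiffAt_id (I := cotModel E) (x := φ₀) (n := ∞))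
  refine (contMDiffAt_hom_bundle _).2 ⟨hproj φ₀, ?_⟩
  have hA₀ := ((smoothEnd_iff A).1 hA φ₀.1).comp φ₀ (hproj φ₀)
  refine (hid.2.clm_comp hA₀).congr_of_eventuallyEq ?_
  filter_upwards [(hproj φ₀).continuousAt.preimage_mem_nhds
    ((trivializationAt E (TangentSpace 𝓘(ℝ, E)) φ₀.1).open_baseSet.mem_nhds
      (FiberBundle.mem_baseSet_trivializationAt' φ₀.1))] with φ hφ
  exact inCoordinates_comp hφ _ _ _ _ _ _

variable [FiniteDimensional ℝ E]

theorem contMDiff_dual (A : Aut₀ E P) : ContMDiff (cotModel E) (cotModel E) ∞ (dual A) :=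
  SmoothEnd.contMDiff_comp A.2

theorem isGenCanonical_Θ (A : Aut₀ E P) : IsGenCanonical (Θ A) :=
  isGenCanonical_semibasicForm (B := fun φ => (dual A φ).2) (contMDiff_dual A)
    (fun φ hφ h => hφ <| ContinuousLinearMap.ext fun v =>
      (congrArg φ.2 ((A.1 φ.1).apply_symm_apply v)).symm.trans
        (DFunLike.congr_fun h ((A.1 φ.1).symm v)))
    (fun _ _ => ⟨fun _ _ => rfl, fun _ _ => rfl⟩)

theorem Θ_injective : Function.Injective (Θ : Aut₀ E P → OneForm E P) := by
  intro A A' h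
  refine Subtype.ext (funext fun p => ContinuousLinearEquiv.ext (funext fun v => ?_))
  refine (SeparatingDual.eq_iff_forall_dual_eq (R := ℝ) (V := E)).2 fun ψ => ?_
  have hdual : (dual A ⟨p, ψ⟩).2 = (dual A' ⟨p, ψ⟩).2 :=
    comp_tProj_injective ⟨p, ψ⟩ (congrFun h ⟨p, ψ⟩)
  exact DFunLike.congr_fun hdual v

theorem tProj_comp_mfderiv_dual (A : Aut₀ E P) (φ : CotangentBundle E P) :
    (tProj (dual A φ)).comp (mfderiv (cotModel E) (cotModel E) (dual A) φ) = tProj φ :=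
  ContinuousLinearMap.ext fun w =>
    mfderiv_proj_mfderiv ((contMDiff_dual A).mdifferentiableAt (by simp)) w

theorem Lstar_Θ (A A' : Aut₀ E P) : Lstar A (Θ A') = Θ (A * A') :=
  funext fun φ => congrArg (ContinuousLinearMap.comp (dual A' (dual A φ)).2)
    (tProj_comp_mfderiv_dual A φ)

end Theta

section Surjectivity

theorem contMDiffAt_comp_continuousLinearMapAt (p₀ : P) (ψ : E →L[ℝ] ℝ) :
    ContMDiffAt 𝓘(ℝ, E) (cotModel E) ∞ (fun p => (⟨p, ψ.comp
      ((trivializationAt E (TangentSpace 𝓘(ℝ, E)) p₀).continuousLinearMapAt ℝ p)⟩ :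
        CotangentBundle E P)) p₀ := by
  refine (contMDiffAt_hom_bundle _).2 ⟨contMDiffAt_id, ?_⟩
  refine (contMDiffAt_const (c := ψ)).congr_of_eventuallyEq ?_
  filter_upwards [(trivializationAt E (TangentSpace 𝓘(ℝ, E)) p₀).open_baseSet.mem_nhds
      (FiberBundle.mem_baseSet_trivializationAt' p₀)] with p hp
  ext v
  simpa [ContinuousLinearMap.inCoordinates] using congrArg ψ
    ((trivializationAt E (TangentSpace 𝓘(ℝ, E)) p₀).continuousLinearMapAt_symmL (R := ℝ) hp v)

variable {B : ∀ φ : CotangentBundle E P, TangentSpace 𝓘(ℝ, E) φ.1 →L[ℝ] ℝ}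

theorem IsGenCanonical.eq_zero_of_apply_eq_zero (hB : IsGenCanonical (semibasicForm B))
    {φ : CotangentBundle E P} (hφ : B φ = 0) : φ.2 = 0 := by
  by_contra hne
  exact hB.ne_zero φ hne ((congrArg (ContinuousLinearMap.comp · (tProj φ)) hφ).trans
    (ContinuousLinearMap.zero_comp _))

variable [FiniteDimensional ℝ E] [T2Space P]

theorem IsGenCanonical.isLinearMap_apply (hB : IsGenCanonical (semibasicForm B)) (p : P)
    (v : TangentSpace 𝓘(ℝ, E) p) :
    IsLinearMap ℝ fun φ : TangentSpace 𝓘(ℝ, E) p →L[ℝ] ℝ => B ⟨p, φ⟩ v := by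
  obtain ⟨ξ, χ, hξ, hχ⟩ := exists_isLinearVectorField p
    ((trivializationAt E (TangentSpace 𝓘(ℝ, E)) p).continuousLinearMapAt ℝ p v)
  have hχp : χ p = v := hχ.self_of_nhds.trans <|
    (trivializationAt E (TangentSpace 𝓘(ℝ, E)) p).symmL_continuousLinearMapAt
      (FiberBundle.mem_baseSet_trivializationAt' p) v
  simpa only [hξ.semibasicForm_apply, hχp] using (hB.linear ξ χ hξ).linear p

theorem IsGenCanonical.exists_fibreAut (hB : IsGenCanonical (semibasicForm B)) :
    ∃ A : FibreAut E P, ∀ φ, B φ = φ.2.comp (A φ.1).toContinuousLinearMap := by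
  have key (p : P) : ∃ A : TangentSpace 𝓘(ℝ, E) p ≃L[ℝ] TangentSpace 𝓘(ℝ, E) p,
      ∀ φ : TangentSpace 𝓘(ℝ, E) p →L[ℝ] ℝ, B ⟨p, φ⟩ = φ.comp A.toContinuousLinearMap := by
    let L : (TangentSpace 𝓘(ℝ, E) p →L[ℝ] ℝ) →ₗ[ℝ] (TangentSpace 𝓘(ℝ, E) p →L[ℝ] ℝ) :=
      { toFun := fun φ => B ⟨p, φ⟩
        map_add' := fun φ ψ =>
          ContinuousLinearMap.ext fun v => (hB.isLinearMap_apply p v).map_add φ ψ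
        map_smul' := fun c φ =>
          ContinuousLinearMap.ext fun v => (hB.isLinearMap_apply p v).map_smul c φ }
    exact exists_continuousLinearEquiv_eq_comp (V := E) L
      ((injective_iff_map_eq_zero L).2 fun φ hφ => hB.eq_zero_of_apply_eq_zero hφ)
  choose A hA using key
  exact ⟨A, fun φ => hA φ.1 φ.2⟩

theorem IsGenCanonical.smoothEnd
    {A : ∀ p : P, TangentSpace 𝓘(ℝ, E) p →L[ℝ] TangentSpace 𝓘(ℝ, E) p}
    (hA : IsGenCanonical (semibasicForm fun φ : CotangentBundle E P => φ.2.comp (A φ.1))) :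
    SmoothEnd E P A := by
  have : CompleteSpace E := FiniteDimensional.complete ℝ E
  refine (smoothEnd_iff A).2 fun p₀ => contMDiffAt_clm_of_apply fun v =>
    contMDiffAt_of_dual_apply fun ψ => ?_
  obtain ⟨ξ, χ, hξ, hχ⟩ := exists_isLinearVectorField p₀ v
  refine (((hA.linear ξ χ hξ).smooth _).comp p₀
    (contMDiffAt_comp_continuousLinearMapAt p₀ ψ)).congr_of_eventuallyEq ?_
  filter_upwards [hχ] with p hp
  refine Eq.trans ?_ (hξ.semibasicForm_apply _).symm
  exact congrArg (fun w => ψ ((trivializationAt E (TangentSpace 𝓘(ℝ, E)) p₀).continuousLinearMapAt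
    ℝ p (A p w))) hp.symm

theorem range_Θ : range (Θ : Aut₀ E P → OneForm E P) = Can E P := by
  refine Subset.antisymm (range_subset_iff.2 isGenCanonical_Θ) fun γ (hγ : IsGenCanonical γ) => ?_
  obtain ⟨B, rfl⟩ := exists_semibasicForm_eq hγ.semibasic
  obtain ⟨A, hA⟩ := hγ.exists_fibreAut
  obtain rfl : B = _ := funext hA
  exact ⟨⟨A, hγ.smoothEnd⟩, rfl⟩

end Surjectivity

end GenCanForm

theorem proposition5 {E : Type*} [NormedAddCommGroup E] [NormedSpace ℝ E] [FiniteDimensional ℝ E]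
    {P : Type*} [TopologicalSpace P] [T2Space P] [ChartedSpace E P]
    [IsManifold 𝓘(ℝ, E) ∞ P] :
    -- the map `Θ` is a bijection from `Aut₀ TP` onto `Can T*P`
    Set.BijOn (GenCanForm.Θ : GenCanForm.Aut₀ E P → GenCanForm.OneForm E P)
      Set.univ (GenCanForm.Can E P) ∧
    -- the maps `A*` along which one pulls back are smooth
    (∀ A : GenCanForm.Aut₀ E P,
      ContMDiff (GenCanForm.cotModel E) (GenCanForm.cotModel E) ∞ (GenCanForm.dual A)) ∧
    -- `L*` is a left action of `Aut₀ TP` on `Can T*P`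
    (∀ A : GenCanForm.Aut₀ E P, ∀ γ ∈ GenCanForm.Can E P,
      GenCanForm.Lstar A γ ∈ GenCanForm.Can E P) ∧
    (∀ γ ∈ GenCanForm.Can E P, GenCanForm.Lstar (1 : GenCanForm.Aut₀ E P) γ = γ) ∧
    (∀ A B : GenCanForm.Aut₀ E P, ∀ γ ∈ GenCanForm.Can E P,
      GenCanForm.Lstar (A * B) γ = GenCanForm.Lstar A (GenCanForm.Lstar B γ)) ∧
    -- the action is transitive
    (∀ γ ∈ GenCanForm.Can E P, ∀ γ' ∈ GenCanForm.Can E P,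
      ∃ A : GenCanForm.Aut₀ E P, GenCanForm.Lstar A γ = γ') ∧
    -- the action is free
    (∀ A : GenCanForm.Aut₀ E P, ∀ γ ∈ GenCanForm.Can E P, GenCanForm.Lstar A γ = γ → A = 1) ∧
    -- equivariance of `Θ`
    (∀ A A' : GenCanForm.Aut₀ E P,
      GenCanForm.Lstar A (GenCanForm.Θ A') = GenCanForm.Θ (A * A')) := by
  rw [← GenCanForm.range_Θ, ← image_univ]
  refine ⟨GenCanForm.Θ_injective.injOn.bijOn_image, GenCanForm.contMDiff_dual, ?_⟩
  rw [image_univ]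
  exact ⟨GenCanForm.act_mem_range GenCanForm.Lstar_Θ,
    GenCanForm.one_act_of_mem_range GenCanForm.Lstar_Θ,
    GenCanForm.mul_act_of_mem_range GenCanForm.Lstar_Θ,
    GenCanForm.exists_act_eq_of_mem_range GenCanForm.Lstar_Θ,
    GenCanForm.eq_one_of_act_eq_self GenCanForm.Lstar_Θ GenCanForm.Θ_injective,
    GenCanForm.Lstar_Θ⟩
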